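/- Let $d,n$ be non-negative integers, $r=\min(d,n)$, and let $h:\mathbb R^r\to[0,\infty)$ be a symmetric gauge function, that is, a norm that is absolute ($h(|x_1|,\dots,|x_r|)=h(x)$) and invariant under permutations of the coordinates. For $X\in\mathbb R^{d\times n}$ let $\sigma(X)\in[0,\infty)^r$ be the vector of singular values of $X$ in non-increasing order. For a real-valued function $f$ on a Euclidean space write $\operatorname{prox}_f(x)=\operatorname{argmin}_y\{\tfrac12\|y-x\|_2^2+f(y)\}$ whenever there is exactly one minimizer; $\mathbb R^{d\times n}$ carries the Frobenius norm. Let $X\in\mathbb R^{d\times n}$ have the singular value decomposition $X=U\operatorname{diag}(\sigma(X))V^{\top}$, where $U\in\mathbb R^{d\times r}$ and $V\in\mathbb R^{n\times r}$ satisfy $U^{\top}U=V^{\top}V=I_r$. Then $\operatorname{prox}_h(\sigma(X))$ and $\operatorname{prox}_{h\circ\sigma}(X)$ are well defined (the minimizers exist and are unique), and $$\operatorname{prox}_{h\circ\sigma}(X)=U\operatorname{diag}\bigl(\operatorname{prox}_h(\sigma(X))\bigr)V^{\top}.$$ -/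

import Mathlib

/- Matrices carry the Frobenius norm, i.e. the Euclidean norm of their entries. -/
open scoped Matrix.Norms.Frobenius

noncomputable section

/-- The objective `y ↦ ½ ‖y - x‖² + f y` defining the proximity operator of `f` at `x`. -/
def proxObjective {E : Type*} [NormedAddCommGroup E] (f : E → ℝ) (x y : E) : ℝ :=
  (1 / 2 : ℝ) * ‖y - x‖ ^ 2 + f y

/-- `p` minimizes `y ↦ ½ ‖y - x‖² + f y` and is its only minimizer. -/
def IsProx {E : Type*} [NormedAddCommGroup E] (f : E → ℝ) (x p : E) : Prop :=
  (∀ y, proxObjective f x p ≤ proxObjective f x y) ∧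
    ∀ q, (∀ y, proxObjective f x q ≤ proxObjective f x y) → q = p

/-- The proximity operator `prox_f (x) = argmin_y { ½ ‖y - x‖² + f y }`. Its value is meaningful
when a unique minimizer exists, i.e. when `IsProx f x (prox f x)`. -/
def prox {E : Type*} [NormedAddCommGroup E] (f : E → ℝ) (x : E) : E :=
  Classical.epsilon (IsProx f x)

/-- A symmetric gauge function on `ℝ^r`: a norm that is absolute and permutation invariant. -/
structure IsSymmetricGauge {r : ℕ} (h : EuclideanSpace ℝ (Fin r) → ℝ) : Prop where
  add_le : ∀ x y, h (x + y) ≤ h x + h y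
  smul : ∀ (c : ℝ) x, h (c • x) = |c| * h x
  eq_zero : ∀ x, h x = 0 → x = 0
  absolute : ∀ x, h (WithLp.toLp 2 fun i => |x i|) = h x
  perm : ∀ (π : Equiv.Perm (Fin r)) x, h (WithLp.toLp 2 fun i => x (π i)) = h x

/-- The vector `σ(X) ∈ ℝ^{min(d,n)}` of the singular values of `X`, in non-increasing order. -/
def singularVector {d n : ℕ} (X : Matrix (Fin d) (Fin n) ℝ) :
    EuclideanSpace ℝ (Fin (min d n)) :=
  WithLp.toLp 2 fun i => (Matrix.toEuclideanLin X).singularValues i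

end

open scoped Matrix

/-! Let p minimize the vector objective and put g = σ(X) - p. Then g is a subgradient of h at p, and
since h is a norm this says ⟨g, p⟩ = h(p) and ⟨g, y⟩ ≤ h(y) for all y. With P = U diag(p) Vᵀ one has
X - P = U diag(g) Vᵀ, so ⟨X - P, Y⟩ = ⟨g, diag(UᵀYV)⟩ ≤ h(diag(UᵀYV)). The crux is
`IsSymmetricGauge.diag_le`, which bounds the last term by h(σ(Y)) and also gives h(σ(P)) ≤ h(p).
Expanding ‖Y - X‖² around P then yields quadratic growth at P, hence minimality and uniqueness
together. Convexity of h ∘ σ and the sign or order of the entries of p are never needed. -/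

theorem IsProx.prox_eq {E : Type*} [NormedAddCommGroup E] {f : E → ℝ} {x p : E}
    (hp : IsProx f x p) : prox f x = p :=
  hp.2 _ (Classical.epsilon_spec (p := IsProx f x) ⟨p, hp⟩).1

/-- Quadratic growth of the objective around `p` makes `p` the proximal point. -/
theorem isProx_of_quadratic_growth {E : Type*} [NormedAddCommGroup E] {f : E → ℝ} {x p : E}
    (H : ∀ y, proxObjective f x p + (1 / 2 : ℝ) * ‖y - p‖ ^ 2 ≤ proxObjective f x y) :
    IsProx f x p := by
  refine ⟨fun y => by nlinarith [H y, sq_nonneg ‖y - p‖], fun q hq => ?_⟩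
  have h0 : ‖q - p‖ = 0 := by
    have := H q
    have := hq p
    exact pow_eq_zero_iff two_ne_zero |>.1 (by nlinarith [sq_nonneg ‖q - p‖])
  exact sub_eq_zero.1 (norm_eq_zero.1 h0)

/-! ### Symmetric gauges and substochastic matrices. -/

namespace IsSymmetricGauge

variable {r : ℕ} {h : EuclideanSpace ℝ (Fin r) → ℝ}

theorem map_zero (hh : IsSymmetricGauge h) : h 0 = 0 := by
  simpa using hh.smul 0 0

theorem nonneg (hh : IsSymmetricGauge h) (x : EuclideanSpace ℝ (Fin r)) : 0 ≤ h x := by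
  have h1 := hh.add_le x ((-1 : ℝ) • x)
  rw [hh.smul] at h1
  simp only [neg_smul, one_smul, add_neg_cancel, hh.map_zero, abs_neg, abs_one, one_mul] at h1
  linarith

theorem convexOn (hh : IsSymmetricGauge h) : ConvexOn ℝ Set.univ h := by
  refine ⟨convex_univ, fun x _ y _ a b ha hb _ => ?_⟩
  simpa [hh.smul, abs_of_nonneg ha, abs_of_nonneg hb] using hh.add_le (a • x) (b • y)

theorem continuous (hh : IsSymmetricGauge h) : Continuous h :=
  hh.convexOn.locallyLipschitz.continuous

theorem sum_le (hh : IsSymmetricGauge h) {ι : Type*} (s : Finset ι)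
    (f : ι → EuclideanSpace ℝ (Fin r)) : h (∑ i ∈ s, f i) ≤ ∑ i ∈ s, h (f i) :=
  Finset.le_sum_of_subadditive h hh.map_zero.le hh.add_le s f

/-- An absolute norm is monotone in the absolute values of the coordinates. -/
theorem mono (hh : IsSymmetricGauge h) {x y : EuclideanSpace ℝ (Fin r)}
    (hxy : ∀ i, |x i| ≤ |y i|) : h x ≤ h y := by
  -- The box of points dominated by |y| is the convex hull of the sign changes of y, and a convex
  -- sublevel set containing these vertices contains the box.
  have hconv : Convex ℝ {z : Fin r → ℝ | h (WithLp.toLp 2 z) ≤ h y} := by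
    intro z hz w hw a b ha hb hab
    have h1 := hh.convexOn.2 (Set.mem_univ (WithLp.toLp 2 z)) (Set.mem_univ (WithLp.toLp 2 w))
      ha hb hab
    rw [← WithLp.toLp_smul, ← WithLp.toLp_smul, ← WithLp.toLp_add] at h1
    simp only [Set.mem_ofPred_eq, smul_eq_mul] at hz hw h1 ⊢
    calc _ ≤ _ := h1
      _ ≤ a * h y + b * h y := by gcongr
      _ = h y := by rw [← add_mul, hab, one_mul]
  have hsub : Set.univ.pi (fun i => ({-|y i|, |y i|} : Set ℝ)) ⊆
      {z : Fin r → ℝ | h (WithLp.toLp 2 z) ≤ h y} := by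
    intro z hz
    have hz' : ∀ i, |z i| = |y i| := fun i => by
      rcases hz i (Set.mem_univ i) with h1 | h1 <;> simp [show z i = _ from h1]
    have h1 := hh.absolute (WithLp.toLp 2 z)
    simp only [hz'] at h1
    rw [hh.absolute y] at h1
    exact h1.ge
  have hx : (fun i => x i) ∈ convexHull ℝ (Set.univ.pi (fun i => ({-|y i|, |y i|} : Set ℝ))) := by
    rw [convexHull_pi]
    intro i _
    simp only []
    rw [convexHull_pair, segment_eq_Icc (by linarith [abs_nonneg (y i)])]
    exact abs_le.1 (hxy i)
  exact convexHull_min hsub hconv hx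

end IsSymmetricGauge

/-- Every doubly substochastic matrix is dominated by a doubly stochastic one. -/
theorem exists_doublyStochastic_ge {ι : Type*} [Fintype ι] [DecidableEq ι] (N : Matrix ι ι ℝ)
    (h0 : ∀ i j, 0 ≤ N i j) (hrow : ∀ i, ∑ j, N i j ≤ 1) (hcol : ∀ j, ∑ i, N i j ≤ 1) :
    ∃ S ∈ doublyStochastic ℝ ι, ∀ i j, N i j ≤ S i j := by
  set δ : ℝ := ∑ i, (1 - ∑ j, N i j) with hδ
  have hδ' : δ = ∑ j, (1 - ∑ i, N i j) := by
    rw [hδ, Finset.sum_sub_distrib, Finset.sum_sub_distrib, Finset.sum_comm]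
  have hr : ∀ i, 0 ≤ 1 - ∑ j, N i j := fun i => by linarith [hrow i]
  have hc : ∀ j, 0 ≤ 1 - ∑ i, N i j := fun j => by linarith [hcol j]
  have hδ0 : 0 ≤ δ := Finset.sum_nonneg fun i _ => hr i
  have hrδ : ∀ i, (1 - ∑ j, N i j) * δ / δ = 1 - ∑ j, N i j := fun i => by
    rcases eq_or_ne δ 0 with h | h
    · rw [h, (Finset.sum_eq_zero_iff_of_nonneg fun i _ => hr i).1 (hδ ▸ h) i (Finset.mem_univ i)]
      simp
    · field_simp
  have hcδ : ∀ j, δ * (1 - ∑ i, N i j) / δ = 1 - ∑ i, N i j := fun j => by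
    rcases eq_or_ne δ 0 with h | h
    · rw [h, (Finset.sum_eq_zero_iff_of_nonneg fun i _ => hc i).1 (hδ' ▸ h) j (Finset.mem_univ j)]
      simp
    · field_simp
  have hadd : ∀ i j, 0 ≤ (1 - ∑ j, N i j) * (1 - ∑ i, N i j) / δ := fun i j =>
    div_nonneg (mul_nonneg (hr i) (hc j)) hδ0
  -- The rank-one term, row deficit times column deficit over the total deficit δ, fills every row
  -- and column. If δ = 0 all deficits vanish, and so does the quotient.
  refine ⟨Matrix.of fun i j => N i j + (1 - ∑ j, N i j) * (1 - ∑ i, N i j) / δ, ?_, fun i j => ?_⟩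
  · rw [mem_doublyStochastic_iff_sum]
    simp only [Matrix.of_apply]
    refine ⟨fun i j => add_nonneg (h0 i j) (hadd i j), fun i => ?_, fun j => ?_⟩
    · rw [Finset.sum_add_distrib, ← Finset.sum_div, ← Finset.mul_sum, ← hδ', hrδ]
      ring
    · rw [Finset.sum_add_distrib, ← Finset.sum_div, ← Finset.sum_mul, ← hδ, hcδ]
      ring
  · rw [Matrix.of_apply]
    linarith [hadd i j]

namespace IsSymmetricGauge

variable {r : ℕ} {h : EuclideanSpace ℝ (Fin r) → ℝ}

/-- By Birkhoff's theorem, S x is a convex combination of permutations of x. -/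
theorem mulVec_le_of_doublyStochastic (hh : IsSymmetricGauge h) {S : Matrix (Fin r) (Fin r) ℝ}
    (hS : S ∈ doublyStochastic ℝ (Fin r)) (x : Fin r → ℝ) :
    h (WithLp.toLp 2 (S *ᵥ x)) ≤ h (WithLp.toLp 2 x) := by
  obtain ⟨w, hw0, hw1, rfl⟩ := exists_eq_sum_perm_of_mem_doublyStochastic hS
  have h1 : WithLp.toLp 2 ((∑ π, w π • π.permMatrix ℝ) *ᵥ x) =
      ∑ π : Equiv.Perm (Fin r), w π • WithLp.toLp 2 fun i => x (π i) := by
    ext i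
    simp [Matrix.sum_mulVec, Matrix.smul_mulVec, Matrix.permMatrix_mulVec]
  rw [h1]
  refine (hh.sum_le _ _).trans_eq ?_
  have h2 : ∀ π : Equiv.Perm (Fin r), h (w π • WithLp.toLp 2 fun i => x (π i)) =
      w π * h (WithLp.toLp 2 x) := fun π => by
    rw [hh.smul, abs_of_nonneg (hw0 π)]
    congr 1
    exact hh.perm π (WithLp.toLp 2 x)
  rw [Finset.sum_congr rfl fun π _ => h2 π, ← Finset.sum_mul, hw1, one_mul]

/-- A matrix dominated entrywise by a doubly substochastic matrix contracts every symmetric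
gauge. -/
theorem mulVec_le_of_substochastic (hh : IsSymmetricGauge h) {M N : Matrix (Fin r) (Fin r) ℝ}
    (hMN : ∀ i j, |M i j| ≤ N i j) (hrow : ∀ i, ∑ j, N i j ≤ 1) (hcol : ∀ j, ∑ i, N i j ≤ 1)
    (x : EuclideanSpace ℝ (Fin r)) :
    h (WithLp.toLp 2 (M *ᵥ x)) ≤ h x := by
  obtain ⟨S, hS, hNS⟩ := exists_doublyStochastic_ge N
    (fun i j => (abs_nonneg _).trans (hMN i j)) hrow hcol
  refine (hh.mono (y := WithLp.toLp 2 (S *ᵥ fun i => |x i|)) fun i => ?_).trans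
    ((hh.mulVec_le_of_doublyStochastic hS _).trans_eq (hh.absolute x))
  refine le_trans ?_ (le_abs_self _)
  simp only [Matrix.mulVec, dotProduct]
  refine (Finset.abs_sum_le_sum_abs _ _).trans (Finset.sum_le_sum fun j _ => ?_)
  rw [abs_mul]
  exact mul_le_mul_of_nonneg_right ((hMN i j).trans (hNS i j)) (abs_nonneg _)

end IsSymmetricGauge

/-! ### Compression to orthonormal frames. -/

theorem orthonormal_col {m ι : Type*} [Fintype m] [Fintype ι] [DecidableEq ι] {U : Matrix m ι ℝ}
    (hU : Uᵀ * U = 1) : Orthonormal ℝ fun i => (WithLp.toLp 2 (U.col i) : EuclideanSpace ℝ m) := by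
  rw [orthonormal_iff_ite]
  intro i j
  have h1 := congrFun (congrFun hU i) j
  rw [Matrix.one_apply, Matrix.mul_apply] at h1
  rw [← h1]
  simp [PiLp.inner_apply, mul_comm]

/-- Bessel's inequality for the columns of a matrix with orthonormal columns. -/
theorem sum_sq_transpose_mul_le_one {m ι : Type*} [Fintype m] [Fintype ι] [DecidableEq ι]
    {U A : Matrix m ι ℝ} (hU : Uᵀ * U = 1) (hA : Aᵀ * A = 1) (j : ι) :
    ∑ i, (Uᵀ * A) i j ^ 2 ≤ 1 := by
  have h1 := (orthonormal_col hU).sum_inner_products_le (s := Finset.univ)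
    (WithLp.toLp 2 (A.col j))
  rw [(orthonormal_col hA).1 j] at h1
  simpa [PiLp.inner_apply, Matrix.mul_apply, mul_comm] using h1

theorem sum_sq_transpose_mul_row_le_one {m ι : Type*} [Fintype m] [Fintype ι] [DecidableEq ι]
    {U A : Matrix m ι ℝ} (hU : Uᵀ * U = 1) (hA : Aᵀ * A = 1) (i : ι) :
    ∑ j, (Uᵀ * A) i j ^ 2 ≤ 1 := by
  simpa only [← Matrix.transpose_apply (Aᵀ * U), Matrix.transpose_mul, Matrix.transpose_transpose]
    using sum_sq_transpose_mul_le_one hA hU i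

/-- Compressing a matrix with singular values `x` to its diagonal in other orthonormal frames does
not increase a symmetric gauge. -/
theorem IsSymmetricGauge.diag_le {r : ℕ} {h : EuclideanSpace ℝ (Fin r) → ℝ}
    (hh : IsSymmetricGauge h) {m k : Type*} [Fintype m] [Fintype k]
    {U A : Matrix m (Fin r) ℝ} {V B : Matrix k (Fin r) ℝ}
    (hU : Uᵀ * U = 1) (hA : Aᵀ * A = 1) (hV : Vᵀ * V = 1) (hB : Bᵀ * B = 1)
    (x : EuclideanSpace ℝ (Fin r)) :
    h (WithLp.toLp 2 (Uᵀ * (A * Matrix.diagonal (fun i => x i) * Bᵀ) * V).diag) ≤ h x := by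
  have hdiag : (Uᵀ * (A * Matrix.diagonal (fun i => x i) * Bᵀ) * V).diag =
      (Matrix.of fun i j => (Uᵀ * A) i j * (Vᵀ * B) i j) *ᵥ x := by
    ext i
    have h1 : Uᵀ * (A * Matrix.diagonal (fun i => x i) * Bᵀ) * V =
        (Uᵀ * A) * Matrix.diagonal (fun i => x i) * (Vᵀ * B)ᵀ := by
      simp [Matrix.mul_assoc]
    rw [h1, Matrix.diag_apply, Matrix.mul_apply]
    simp only [Matrix.mul_diagonal, Matrix.transpose_apply, Matrix.mulVec, dotProduct,
      Matrix.of_apply]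
    exact Finset.sum_congr rfl fun j _ => by ring
  rw [hdiag]
  -- By AM-GM, |ab| ≤ (a² + b²)/2; Bessel bounds the row and column sums of the squares by 1.
  refine hh.mulVec_le_of_substochastic
    (N := Matrix.of fun i j => ((Uᵀ * A) i j ^ 2 + (Vᵀ * B) i j ^ 2) / 2) (fun i j => ?_) (fun i => ?_)
    (fun j => ?_) x
  · rw [Matrix.of_apply, Matrix.of_apply, abs_le]
    constructor <;> nlinarith [sq_nonneg ((Uᵀ * A) i j + (Vᵀ * B) i j),
      sq_nonneg ((Uᵀ * A) i j - (Vᵀ * B) i j)]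
  · simp only [Matrix.of_apply]
    rw [← Finset.sum_div, Finset.sum_add_distrib]
    linarith [sum_sq_transpose_mul_row_le_one hU hA i, sum_sq_transpose_mul_row_le_one hV hB i]
  · simp only [Matrix.of_apply]
    rw [← Finset.sum_div, Finset.sum_add_distrib]
    linarith [sum_sq_transpose_mul_le_one hU hA j, sum_sq_transpose_mul_le_one hV hB j]

/-! ### Singular value decomposition. -/

theorem LinearMap.inner_map_eigenvectorBasis {n : ℕ} {E F : Type*} [NormedAddCommGroup E]
    [InnerProductSpace ℝ E] [FiniteDimensional ℝ E] [NormedAddCommGroup F] [InnerProductSpace ℝ F]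
    [FiniteDimensional ℝ F] (T : E →ₗ[ℝ] F) (hn : Module.finrank ℝ E = n) (i j : Fin n) :
    inner ℝ (T (T.isSymmetric_adjoint_comp_self.eigenvectorBasis hn i))
      (T (T.isSymmetric_adjoint_comp_self.eigenvectorBasis hn j)) =
        if i = j then T.singularValues i ^ 2 else 0 := by
  rw [← LinearMap.adjoint_inner_left, ← LinearMap.comp_apply,
    T.isSymmetric_adjoint_comp_self.apply_eigenvectorBasis hn, inner_smul_left,
    orthonormal_iff_ite.1 (OrthonormalBasis.orthonormal _) i j, T.sq_singularValues_fin hn]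
  simp

theorem transpose_mul_self_of_orthonormal {m ι : Type*} [Fintype m] [Fintype ι] [DecidableEq ι]
    {v : ι → EuclideanSpace ℝ m} (hv : Orthonormal ℝ v) :
    (Matrix.of fun k i => v i k)ᵀ * (Matrix.of fun k i => v i k) = 1 := by
  ext i j
  rw [Matrix.one_apply, ← orthonormal_iff_ite.1 hv i j]
  simp [Matrix.mul_apply, PiLp.inner_apply, mul_comm]

/-- Singular value decomposition. -/
theorem exists_svd {d n : ℕ} (Y : Matrix (Fin d) (Fin n) ℝ) :
    ∃ (A : Matrix (Fin d) (Fin (min d n)) ℝ) (B : Matrix (Fin n) (Fin (min d n)) ℝ),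
      Aᵀ * A = 1 ∧ Bᵀ * B = 1 ∧
        Y = A * Matrix.diagonal (fun i => singularVector Y i) * Bᵀ := by
  set T := Matrix.toEuclideanLin Y with hT
  have hn : Module.finrank ℝ (EuclideanSpace ℝ (Fin n)) = n := by simp
  obtain ⟨b, hinner⟩ : ∃ b : OrthonormalBasis (Fin n) ℝ (EuclideanSpace ℝ (Fin n)),
      ∀ i j : Fin n, inner ℝ (T (b i)) (T (b j)) =
        if i = j then T.singularValues i ^ 2 else 0 :=
    ⟨_, T.inner_map_eigenvectorBasis hn⟩
  have hzero : ∀ i : Fin n, T.singularValues i = 0 → T (b i) = 0 := fun i hi => by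
    have h1 := hinner i i
    rw [if_pos rfl, hi] at h1
    exact inner_self_eq_zero.1 (h1.trans (by norm_num))
  have hrank : ∀ i : ℕ, d ≤ i → T.singularValues i = 0 := fun i hi => by
    rw [T.singularValues_eq_zero_iff_le_finrank_range]
    exact (Submodule.finrank_le _).trans (by simpa using hi)
  -- Left singular vectors, meaningful only on `s`; the extension to a basis `c` replaces the
  -- remaining ones.
  let v : Fin d → EuclideanSpace ℝ (Fin d) := fun i =>
    if hi : (i : ℕ) < n then (T.singularValues i)⁻¹ • T (b ⟨i, hi⟩) else 0
  let s : Set (Fin d) := {i | (i : ℕ) < n ∧ T.singularValues i ≠ 0}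
  have hv : Orthonormal ℝ (s.domRestrict v) := by
    rw [orthonormal_iff_ite]
    rintro ⟨i, hi, hi'⟩ ⟨j, hj, hj'⟩
    simp only [Set.domRestrict_apply, v, dif_pos hi, dif_pos hj, inner_smul_left, inner_smul_right,
      hinner, Subtype.mk.injEq, Fin.ext_iff]
    split_ifs with hij
    · rw [← hij]
      simp
      field_simp
    · simp
  obtain ⟨c, hc⟩ := hv.exists_orthonormalBasis_extension_of_card_eq (by simp)
  have hTb : ∀ i : Fin (min d n), T (b (Fin.castLE (min_le_right _ _) i)) =
      T.singularValues i • c (Fin.castLE (min_le_left _ _) i) := fun i => by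
    by_cases h0 : T.singularValues i = 0
    · rw [h0, zero_smul]
      exact hzero _ h0
    · have hi : (i : ℕ) < n := lt_of_lt_of_le i.2 (min_le_right _ _)
      rw [hc _ (show Fin.castLE (min_le_left _ _) i ∈ s from ⟨hi, h0⟩)]
      simp only [v, Fin.val_castLE, dif_pos hi, smul_smul, mul_inv_cancel₀ h0, one_smul]
      rfl
  refine ⟨Matrix.of fun k i => c (Fin.castLE (min_le_left _ _) i) k,
    Matrix.of fun k i => b (Fin.castLE (min_le_right _ _) i) k, ?_, ?_, ?_⟩
  · exact transpose_mul_self_of_orthonormal (c.orthonormal.comp _ (Fin.castLE_injective _))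
  · exact transpose_mul_self_of_orthonormal (b.orthonormal.comp _ (Fin.castLE_injective _))
  · ext k l
    have h1 : Y k l = T (EuclideanSpace.single l 1) k := by simp [hT, Matrix.toLpLin_apply]
    have h2 : T (EuclideanSpace.single l 1) = ∑ j, b j l • T (b j) := by
      conv_lhs => rw [← b.sum_repr' (EuclideanSpace.single l 1)]
      rw [map_sum]
      exact Finset.sum_congr rfl fun j _ => by simp [PiLp.inner_apply]
    rw [h1, h2, Matrix.mul_apply]
    simp only [Matrix.mul_diagonal, Matrix.of_apply, Matrix.transpose_apply, WithLp.ofLp_sum,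
      Finset.sum_apply, PiLp.smul_apply, smul_eq_mul, singularVector]
    symm
    refine Finset.sum_of_injOn (Fin.castLE (min_le_right _ _))
      (Fin.castLE_injective _).injOn (by simp) (fun j _ hj => ?_) fun i _ => ?_
    -- Indices missed by the embedding satisfy d ≤ j, beyond the rank.
    · have hj' : T.singularValues j = 0 := hrank _ (by
        by_contra! hlt
        exact hj ⟨⟨j, lt_min hlt j.2⟩, by simp, by simp⟩)
      simp [hzero j hj']
    · rw [hTb]
      simp [hT]
      ring

theorem Matrix.frobenius_norm_sq {m k : Type*} [Fintype m] [Fintype k] (A : Matrix m k ℝ) :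
    ‖A‖ ^ 2 = (Aᵀ * A).trace := by
  rw [Matrix.frobenius_norm_def, ← Real.sqrt_eq_rpow, Real.sq_sqrt (by positivity),
    Matrix.trace, Finset.sum_comm]
  simp [Matrix.mul_apply, sq]

/-- Expansion of the squared distance of `Y` to `X` around `P`. -/
theorem Matrix.frobenius_norm_sub_sq {m k : Type*} [Fintype m] [Fintype k]
    (X Y P : Matrix m k ℝ) :
    ‖Y - X‖ ^ 2 =
      ‖P - X‖ ^ 2 + ‖Y - P‖ ^ 2 - 2 * (((X - P)ᵀ * Y).trace - ((X - P)ᵀ * P).trace) := by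
  have h1 : (Xᵀ * Y).trace = (Yᵀ * X).trace := by
    rw [← Matrix.trace_transpose, Matrix.transpose_mul, Matrix.transpose_transpose]
  have h2 : (Pᵀ * Y).trace = (Yᵀ * P).trace := by
    rw [← Matrix.trace_transpose, Matrix.transpose_mul, Matrix.transpose_transpose]
  have h3 : (Xᵀ * P).trace = (Pᵀ * X).trace := by
    rw [← Matrix.trace_transpose, Matrix.transpose_mul, Matrix.transpose_transpose]
  simp only [Matrix.frobenius_norm_sq, Matrix.transpose_sub, Matrix.sub_mul, Matrix.mul_sub,
    Matrix.trace_sub, h1, h2, h3]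
  ring

/-! ### Proximal points of convex functions. -/

section Prox

variable {E : Type*} [NormedAddCommGroup E] [InnerProductSpace ℝ E]

theorem exists_forall_proxObjective_le [FiniteDimensional ℝ E] {f : E → ℝ} (hf : Continuous f)
    (h0 : ∀ x, 0 ≤ f x) (x : E) :
    ∃ p, ∀ y, proxObjective f x p ≤ proxObjective f x y := by
  have hcont : Continuous (proxObjective f x) := by
    unfold proxObjective
    fun_prop
  refine hcont.exists_forall_le_of_isBounded x
    (Metric.isBounded_closedBall (x := x) (r := √(2 * f x)) |>.subset fun y hy => ?_)
  have hy' : (1 / 2 : ℝ) * ‖y - x‖ ^ 2 + f y ≤ f x := by simpa [proxObjective] using hy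
  rw [Metric.mem_closedBall, dist_eq_norm]
  exact Real.le_sqrt_of_sq_le (by linarith [h0 y])

/-- A minimizer `p` of the proximal objective of a convex function satisfies `x - p ∈ ∂f(p)`. -/
theorem inner_le_sub_of_forall_proxObjective_le {f : E → ℝ} (hf : ConvexOn ℝ Set.univ f) {x p : E}
    (hp : ∀ y, proxObjective f x p ≤ proxObjective f x y) (y : E) :
    inner ℝ (x - p) (y - p) ≤ f y - f p := by
  -- Compare p with the point at parameter t on the segment to y and divide by t; the error term
  -- vanishes as t → 0.
  have key : ∀ t : ℝ, 0 < t → t ≤ 1 →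
      inner ℝ (x - p) (y - p) - (f y - f p) ≤ t * (1 / 2 * ‖y - p‖ ^ 2) := by
    intro t ht ht1
    have h1 := hp ((1 - t) • p + t • y)
    have h2 := hf.2 (Set.mem_univ p) (Set.mem_univ y) (sub_nonneg.2 ht1) ht.le (by ring)
    have h3 : (1 - t) • p + t • y - x = t • (y - p) - (x - p) := by module
    have h4 : ‖p - x‖ = ‖x - p‖ := norm_sub_rev _ _
    simp only [proxObjective] at h1
    rw [h3, h4, norm_sub_sq_real (t • (y - p)), norm_smul, inner_smul_left, mul_pow, Real.norm_eq_abs, sq_abs,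
      real_inner_comm] at h1
    simp only [smul_eq_mul, conj_trivial] at h1 h2
    have h5 : t * (inner ℝ (x - p) (y - p) - (f y - f p)) ≤ t * (t * (1 / 2 * ‖y - p‖ ^ 2)) := by
      linarith
    exact le_of_mul_le_mul_left h5 ht
  refine sub_nonpos.1 (le_of_forall_pos_le_add fun ε hε => ?_)
  have hC : 0 ≤ 1 / 2 * ‖y - p‖ ^ 2 := by positivity
  have ht : 0 < min 1 (ε / (1 / 2 * ‖y - p‖ ^ 2 + 1)) := lt_min one_pos (by positivity)
  refine (key _ ht (min_le_left _ _)).trans ?_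
  calc _ ≤ ε / (1 / 2 * ‖y - p‖ ^ 2 + 1) * (1 / 2 * ‖y - p‖ ^ 2 + 1) := by
        gcongr
        · exact min_le_right _ _
        · linarith
    _ = 0 + ε := by field_simp; ring

theorem isProx_of_forall_proxObjective_le {f : E → ℝ} (hf : ConvexOn ℝ Set.univ f) {x p : E}
    (hp : ∀ y, proxObjective f x p ≤ proxObjective f x y) : IsProx f x p := by
  refine isProx_of_quadratic_growth fun y => ?_
  have h1 := inner_le_sub_of_forall_proxObjective_le hf hp y
  have h2 : y - x = (y - p) - (x - p) := by abel
  simp only [proxObjective]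
  rw [h2, norm_sub_sq_real (y - p), norm_sub_rev p x, real_inner_comm]
  linarith

end Prox

/-! ### Transfer from vectors to matrices. -/

theorem trace_transpose_mul_eq_inner_diag {m k : Type*} [Fintype m] [Fintype k] {r : ℕ}
    (U : Matrix m (Fin r) ℝ) (V : Matrix k (Fin r) ℝ) (g : EuclideanSpace ℝ (Fin r))
    (Y : Matrix m k ℝ) :
    ((U * Matrix.diagonal (fun i => g i) * Vᵀ)ᵀ * Y).trace =
      inner ℝ g (WithLp.toLp 2 (Uᵀ * Y * V).diag) := by
  rw [Matrix.transpose_mul, Matrix.transpose_mul, Matrix.transpose_transpose,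
    Matrix.diagonal_transpose, Matrix.mul_assoc, Matrix.trace_mul_comm, Matrix.mul_assoc,
    Matrix.mul_assoc, Matrix.trace, PiLp.inner_apply]
  simp [Matrix.diagonal_mul, Matrix.mul_assoc, mul_comm]

theorem proposition3p1 (d n : ℕ) (h : EuclideanSpace ℝ (Fin (min d n)) → ℝ)
    (hh : IsSymmetricGauge h) (X : Matrix (Fin d) (Fin n) ℝ)
    (U : Matrix (Fin d) (Fin (min d n)) ℝ) (V : Matrix (Fin n) (Fin (min d n)) ℝ)
    (hU : U.transpose * U = 1) (hV : V.transpose * V = 1)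
    (hX : X = U * Matrix.diagonal (fun i => singularVector X i) * V.transpose) :
    IsProx h (singularVector X) (prox h (singularVector X)) ∧
    IsProx (h ∘ singularVector) X (prox (h ∘ singularVector) X) ∧
    prox (h ∘ singularVector) X =
      U * Matrix.diagonal (fun i => prox h (singularVector X) i) * V.transpose := by
  obtain ⟨p, hp⟩ := exists_forall_proxObjective_le hh.continuous hh.nonneg (singularVector X)
  have hprox := isProx_of_forall_proxObjective_le hh.convexOn hp
  have hsub := inner_le_sub_of_forall_proxObjective_le hh.convexOn hp
  set g := singularVector X - p with hg
  -- Testing the subgradient inequality at 0 and 2p gives the two inequalities.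
  have hgp : inner ℝ g p = h p := by
    have h1 := hsub 0
    have h2 := hsub ((2 : ℝ) • p)
    rw [zero_sub, inner_neg_right, hh.map_zero] at h1
    rw [hh.smul, two_smul, add_sub_cancel_right, abs_two] at h2
    linarith
  have hgy : ∀ y, inner ℝ g y ≤ h y := fun y => by
    have h1 := hsub y
    rw [inner_sub_right, hgp] at h1
    linarith
  set P := U * Matrix.diagonal (fun i => p i) * Vᵀ with hP
  have hXP : X - P = U * Matrix.diagonal (fun i => g i) * Vᵀ := by
    rw [hP]
    nth_rewrite 1 [hX]
    rw [← Matrix.sub_mul, ← Matrix.mul_sub, Matrix.diagonal_sub]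
    simp [hg]
  have hdiagP : Uᵀ * P * V = Matrix.diagonal fun i => p i := by
    have h1 : Uᵀ * P * V = (Uᵀ * U) * Matrix.diagonal (fun i => p i) * (Vᵀ * V) := by
      simp only [hP, Matrix.mul_assoc]
    rw [h1, hU, hV, Matrix.one_mul, Matrix.mul_one]
  have htrP : ((X - P)ᵀ * P).trace = h p := by
    rw [hXP, trace_transpose_mul_eq_inner_diag, hdiagP, Matrix.diag_diagonal, ← hgp]
  have htrY : ∀ Y, ((X - P)ᵀ * Y).trace ≤ h (singularVector Y) := fun Y => by
    obtain ⟨A, B, hA, hB, hY⟩ := exists_svd Y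
    rw [hXP, trace_transpose_mul_eq_inner_diag]
    refine (hgy _).trans ?_
    nth_rewrite 1 [hY]
    exact hh.diag_le hU hA hV hB _
  have hσP : h (singularVector P) ≤ h p := by
    obtain ⟨A, B, hA, hB, hY⟩ := exists_svd P
    have h1 : Aᵀ * P * B = Matrix.diagonal fun i => singularVector P i := by
      nth_rewrite 1 [hY]
      rw [Matrix.mul_assoc, Matrix.mul_assoc, Matrix.mul_assoc, hB, Matrix.mul_one,
        ← Matrix.mul_assoc, hA, Matrix.one_mul]
    -- The frames swap roles here: the diagonal of P in its own singular frames is σ(P).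
    have h2 := hh.diag_le hA hU hB hV p
    rw [← hP, h1, Matrix.diag_diagonal] at h2
    exact h2
  have hproxM : IsProx (h ∘ singularVector) X P := by
    refine isProx_of_quadratic_growth fun Y => ?_
    simp only [proxObjective, Function.comp_apply]
    rw [Matrix.frobenius_norm_sub_sq X Y P]
    linarith [htrY Y]
  rw [hprox.prox_eq, hproxM.prox_eq]
  exact ⟨hprox, hproxM, rfl⟩
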